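/- All rings are associative, not necessarily with unity. For additive subgroups $S,T$ of a ring $R$, $[S,T]$ denotes the additive subgroup generated by all $st-ts$ with $s\in S$, $t\in T$; $Z(R)$ is the center of $R$. Let $R$ be a prime ring, i.e. $R\neq 0$ and, for $a,b\in R$, $aRb=0$ implies $a=0$ or $b=0$. Let $Q_s(R)\supseteq R$ be its symmetric Martindale ring of quotients, and let the field $C=Z(Q_s(R))$ be its extended centroid; for an additive subgroup $S$ of $R$, $SC$ denotes the $C$-subspace of $Q_s(R)$ spanned by $S$. Assume that $R$ is exceptional, i.e. $\operatorname{char} R=2$ and $\dim_C RC=4$. Let $A$ be an additive subgroup of $R$ with $A\not\subseteq Z(R)$, and let $I$ be a nonzero (two-sided) ideal of $R$ such that $[A,I]\subseteq A$. Then either $A$ contains a proper Lie ideal of $R$, i.e. $[M,R]\subseteq A$ for some nonzero ideal $M$ of $R$, or $AC=Ca+C$ for some $a\in A\setminus Z(R)$ with $a^2\in Z(R)$. -/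

import Mathlib

namespace PrimeRings

/-- An associative ring, not necessarily with unity, is prime if it is nonzero and `a R b = 0`
implies `a = 0` or `b = 0`. -/
class IsPrimeRing (R : Type*) [NonUnitalRing R] : Prop extends Nontrivial R where
  eq_zero_or_eq_zero : ∀ a b : R, (∀ r : R, a * r * b = 0) → a = 0 ∨ b = 0

section Basic

variable {R : Type*} [NonUnitalRing R]

/-- The additive subgroup `[S, T]` generated by all commutators `s t - t s` with `s ∈ S`,
`t ∈ T`. -/
def commutatorSubgroup (S T : Set R) : AddSubgroup R :=
  AddSubgroup.closure {z | ∃ s ∈ S, ∃ t ∈ T, z = s * t - t * s}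

/-- A proper Lie ideal: one of the form `[M, R]` with `M` a nonzero ideal of `R`. -/
def IsProperLieIdeal (L : AddSubgroup R) : Prop :=
  ∃ M : TwoSidedIdeal R, M ≠ ⊥ ∧ L = commutatorSubgroup (M : Set R) Set.univ

theorem exists_ne_zero_of_ne_bot {I : TwoSidedIdeal R} (hI : I ≠ ⊥) : ∃ x ∈ I, x ≠ 0 := by
  by_contra! h
  exact hI (le_bot_iff.1 fun x hx => (TwoSidedIdeal.mem_bot R).2 (h x hx))

theorem ne_bot_of_mem {I : TwoSidedIdeal R} {x : R} (hx : x ∈ I) (h0 : x ≠ 0) : I ≠ ⊥ := by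
  rintro rfl
  exact h0 ((TwoSidedIdeal.mem_bot R).1 hx)

theorem top_ne_bot [IsPrimeRing R] : (⊤ : TwoSidedIdeal R) ≠ ⊥ := by
  obtain ⟨x, hx⟩ := exists_ne (0 : R)
  exact ne_bot_of_mem (TwoSidedIdeal.mem_top R) hx

theorem exists_mul_mul_ne_zero [IsPrimeRing R] {a b : R} (ha : a ≠ 0) (hb : b ≠ 0) :
    ∃ r : R, a * r * b ≠ 0 := by
  by_contra! h
  exact (IsPrimeRing.eq_zero_or_eq_zero a b h).elim ha hb

theorem inf_ne_bot [IsPrimeRing R] {I J : TwoSidedIdeal R} (hI : I ≠ ⊥) (hJ : J ≠ ⊥) :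
    I ⊓ J ≠ ⊥ := by
  obtain ⟨x, hx, hx0⟩ := exists_ne_zero_of_ne_bot hI
  obtain ⟨y, hy, hy0⟩ := exists_ne_zero_of_ne_bot hJ
  obtain ⟨r, hr⟩ := exists_mul_mul_ne_zero hx0 hy0
  refine ne_bot_of_mem ((TwoSidedIdeal.mem_inf R).2 ⟨?_, ?_⟩) hr
  · exact I.mul_mem_right _ _ (I.mul_mem_right _ _ hx)
  · exact J.mul_mem_left _ _ hy

/-- The square `I²` of a two-sided ideal: the additive subgroup generated by the products of two
elements of `I`. -/
def idealSq (I : TwoSidedIdeal R) : TwoSidedIdeal R :=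
  TwoSidedIdeal.mk' (AddSubgroup.closure {z : R | ∃ x ∈ I, ∃ y ∈ I, z = x * y} : Set R)
    (zero_mem _) (fun h k => add_mem h k) (fun h => neg_mem h)
    (by
      intro r x hx
      refine AddSubgroup.closure_induction (p := fun x _ => r * x ∈ AddSubgroup.closure
        {z : R | ∃ x ∈ I, ∃ y ∈ I, z = x * y}) ?_ ?_ ?_ ?_ hx
      · rintro _ ⟨x, hx, y, hy, rfl⟩
        exact AddSubgroup.subset_closure
          ⟨r * x, I.mul_mem_left _ _ hx, y, hy, (mul_assoc _ _ _).symm⟩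
      · simp
      · intro x y _ _ h k
        rw [mul_add]; exact add_mem h k
      · intro x _ h
        rw [mul_neg]; exact neg_mem h)
    (by
      intro x r hx
      refine AddSubgroup.closure_induction (p := fun x _ => x * r ∈ AddSubgroup.closure
        {z : R | ∃ x ∈ I, ∃ y ∈ I, z = x * y}) ?_ ?_ ?_ ?_ hx
      · rintro _ ⟨x, hx, y, hy, rfl⟩
        exact AddSubgroup.subset_closure
          ⟨x, hx, y * r, I.mul_mem_right _ _ hy, mul_assoc _ _ _⟩
      · simp
      · intro x y _ _ h k
        rw [add_mul]; exact add_mem h k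
      · intro x _ h
        rw [neg_mul]; exact neg_mem h)

theorem mem_idealSq {I : TwoSidedIdeal R} {x : R} :
    x ∈ idealSq I ↔ x ∈ AddSubgroup.closure {z : R | ∃ x ∈ I, ∃ y ∈ I, z = x * y} := by
  unfold idealSq
  rw [TwoSidedIdeal.mem_mk']
  rfl

theorem idealSq_induction {I : TwoSidedIdeal R} {p : R → Prop} {x : R} (hx : x ∈ idealSq I)
    (hmul : ∀ x ∈ I, ∀ y ∈ I, p (x * y)) (h0 : p 0)
    (hadd : ∀ x ∈ I, ∀ y ∈ I, p x → p y → p (x + y)) (hneg : ∀ x ∈ I, p x → p (-x)) :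
    x ∈ I ∧ p x := by
  refine AddSubgroup.closure_induction (p := fun x _ => x ∈ I ∧ p x) ?_ ?_ ?_ ?_
    (mem_idealSq.1 hx)
  · rintro _ ⟨x, hx, y, hy, rfl⟩
    exact ⟨I.mul_mem_left _ _ hy, hmul x hx y hy⟩
  · exact ⟨zero_mem _, h0⟩
  · intro x y _ _ h k
    exact ⟨add_mem h.1 k.1, hadd x h.1 y k.1 h.2 k.2⟩
  · intro x _ h
    exact ⟨neg_mem h.1, hneg x h.1 h.2⟩

theorem idealSq_le (I : TwoSidedIdeal R) {x : R} (hx : x ∈ idealSq I) : x ∈ I :=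
  (idealSq_induction (p := fun _ => True) hx (by simp) (by simp) (by simp) (by simp)).1

theorem idealSq_ne_bot [IsPrimeRing R] {I : TwoSidedIdeal R} (hI : I ≠ ⊥) :
    idealSq I ≠ ⊥ := by
  obtain ⟨x, hx, hx0⟩ := exists_ne_zero_of_ne_bot hI
  obtain ⟨r, hr⟩ := exists_mul_mul_ne_zero hx0 hx0
  exact ne_bot_of_mem (mem_idealSq.2 (AddSubgroup.subset_closure
    ⟨x * r, I.mul_mem_right _ _ hx, x, hx, rfl⟩)) hr

end Basic

/-- A balanced pair on a nonzero ideal `J` of `R`: a right `R`-module map `f : J → R` and a left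
`R`-module map `g : J → R` with `x f(y) = g(x) y` for `x, y ∈ J`. It represents an element `q` of
the symmetric Martindale ring of quotients through `f(x) = q x`, `g(x) = x q`. The maps are given
by functions on `R` of which only the values on `J` matter. -/
structure BalancedPair (R : Type*) [NonUnitalRing R] where
  J : TwoSidedIdeal R
  J_ne_bot : J ≠ ⊥
  f : R → R
  g : R → R
  f_add : ∀ x ∈ J, ∀ y ∈ J, f (x + y) = f x + f y
  g_add : ∀ x ∈ J, ∀ y ∈ J, g (x + y) = g x + g y
  f_mul : ∀ x ∈ J, ∀ r : R, f (x * r) = f x * r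
  g_mul : ∀ r : R, ∀ x ∈ J, g (r * x) = r * g x
  balanced : ∀ x ∈ J, ∀ y ∈ J, x * f y = g x * y

namespace BalancedPair

variable {R : Type*} [NonUnitalRing R]

theorem f_zero (p : BalancedPair R) : p.f 0 = 0 := by
  have := p.f_mul 0 (zero_mem _) 0
  simpa using this

theorem g_zero (p : BalancedPair R) : p.g 0 = 0 := by
  have := p.g_mul 0 0 (zero_mem _)
  simpa using this

theorem f_neg (p : BalancedPair R) {x : R} (hx : x ∈ p.J) : p.f (-x) = -p.f x := by
  have := p.f_add (-x) (neg_mem hx) x hx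
  rw [neg_add_cancel, p.f_zero] at this
  exact eq_neg_of_add_eq_zero_left this.symm

theorem g_neg (p : BalancedPair R) {x : R} (hx : x ∈ p.J) : p.g (-x) = -p.g x := by
  have := p.g_add (-x) (neg_mem hx) x hx
  rw [neg_add_cancel, p.g_zero] at this
  exact eq_neg_of_add_eq_zero_left this.symm

/-- On `I²`, with `I ⊆ J`, the map `f` takes values in `I`. -/
theorem f_mem (p : BalancedPair R) {I : TwoSidedIdeal R} (hI : ∀ x ∈ I, x ∈ p.J) {x : R}
    (hx : x ∈ idealSq I) : p.f x ∈ I := by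
  refine (idealSq_induction (p := fun x => p.f x ∈ I) hx ?_ ?_ ?_ ?_).2
  · intro x hx y hy
    rw [p.f_mul x (hI x hx)]
    exact I.mul_mem_left _ _ hy
  · rw [p.f_zero]; exact zero_mem _
  · intro x hx y hy h k
    rw [p.f_add x (hI x hx) y (hI y hy)]; exact add_mem h k
  · intro x hx h
    rw [p.f_neg (hI x hx)]; exact neg_mem h

/-- On `I²`, with `I ⊆ J`, the map `g` takes values in `I`. -/
theorem g_mem (p : BalancedPair R) {I : TwoSidedIdeal R} (hI : ∀ x ∈ I, x ∈ p.J) {x : R}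
    (hx : x ∈ idealSq I) : p.g x ∈ I := by
  refine (idealSq_induction (p := fun x => p.g x ∈ I) hx ?_ ?_ ?_ ?_).2
  · intro x hx y hy
    rw [p.g_mul x y (hI y hy)]
    exact I.mul_mem_right _ _ hx
  · rw [p.g_zero]; exact zero_mem _
  · intro x hx y hy h k
    rw [p.g_add x (hI x hx) y (hI y hy)]; exact add_mem h k
  · intro x hx h
    rw [p.g_neg (hI x hx)]; exact neg_mem h

/-- Two balanced pairs are equivalent if they agree on some nonzero ideal contained in both
domains. -/
def Equiv (p q : BalancedPair R) : Prop :=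
  ∃ K : TwoSidedIdeal R, K ≠ ⊥ ∧ ∀ x ∈ K, x ∈ p.J ∧ x ∈ q.J ∧ p.f x = q.f x ∧ p.g x = q.g x

variable [IsPrimeRing R]

theorem Equiv.of_forall {p q : BalancedPair R}
    (h : ∀ x, x ∈ p.J → x ∈ q.J → p.f x = q.f x ∧ p.g x = q.g x) : Equiv p q :=
  ⟨p.J ⊓ q.J, inf_ne_bot p.J_ne_bot q.J_ne_bot, fun x hx =>
    have hx' := (TwoSidedIdeal.mem_inf R).1 hx
    ⟨hx'.1, hx'.2, h x hx'.1 hx'.2⟩⟩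

instance setoid (R : Type*) [NonUnitalRing R] [IsPrimeRing R] : Setoid (BalancedPair R) where
  r := Equiv
  iseqv :=
    { refl := fun p => Equiv.of_forall fun _ _ _ => ⟨rfl, rfl⟩
      symm := fun ⟨K, hK, h⟩ => ⟨K, hK, fun x hx =>
        let ⟨h1, h2, h3, h4⟩ := h x hx
        ⟨h2, h1, h3.symm, h4.symm⟩⟩
      trans := fun ⟨K, hK, h⟩ ⟨L, hL, k⟩ => ⟨K ⊓ L, inf_ne_bot hK hL, fun x hx =>
        let ⟨hx1, hx2⟩ := (TwoSidedIdeal.mem_inf R).1 hx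
        let ⟨h1, _, h3, h4⟩ := h x hx1
        let ⟨_, k2, k3, k4⟩ := k x hx2
        ⟨h1, k2, h3.trans k3, h4.trans k4⟩⟩ }

/-- The pair of left and right multiplication by `r ∈ R`. -/
def ofElement (r : R) : BalancedPair R where
  J := ⊤
  J_ne_bot := top_ne_bot
  f x := r * x
  g x := x * r
  f_add _ _ _ _ := mul_add _ _ _
  g_add _ _ _ _ := add_mul _ _ _
  f_mul _ _ _ := (mul_assoc _ _ _).symm
  g_mul _ _ _ := mul_assoc _ _ _
  balanced _ _ _ _ := (mul_assoc _ _ _).symm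

/-- The pair of identity maps. -/
def one : BalancedPair R where
  J := ⊤
  J_ne_bot := top_ne_bot
  f x := x
  g x := x
  f_add _ _ _ _ := rfl
  g_add _ _ _ _ := rfl
  f_mul _ _ _ := rfl
  g_mul _ _ _ := rfl
  balanced _ _ _ _ := rfl

/-- Pointwise sum. -/
def add (p q : BalancedPair R) : BalancedPair R where
  J := p.J ⊓ q.J
  J_ne_bot := inf_ne_bot p.J_ne_bot q.J_ne_bot
  f x := p.f x + q.f x
  g x := p.g x + q.g x
  f_add x hx y hy := by
    rw [TwoSidedIdeal.mem_inf] at hx hy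
    rw [p.f_add x hx.1 y hy.1, q.f_add x hx.2 y hy.2]; abel
  g_add x hx y hy := by
    rw [TwoSidedIdeal.mem_inf] at hx hy
    rw [p.g_add x hx.1 y hy.1, q.g_add x hx.2 y hy.2]; abel
  f_mul x hx r := by
    rw [TwoSidedIdeal.mem_inf] at hx
    rw [p.f_mul x hx.1, q.f_mul x hx.2, add_mul]
  g_mul r x hx := by
    rw [TwoSidedIdeal.mem_inf] at hx
    rw [p.g_mul r x hx.1, q.g_mul r x hx.2, mul_add]
  balanced x hx y hy := by
    rw [TwoSidedIdeal.mem_inf] at hx hy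
    rw [mul_add, add_mul, p.balanced x hx.1 y hy.1, q.balanced x hx.2 y hy.2]

/-- Pointwise negative. -/
def neg (p : BalancedPair R) : BalancedPair R where
  J := p.J
  J_ne_bot := p.J_ne_bot
  f x := -p.f x
  g x := -p.g x
  f_add x hx y hy := by rw [p.f_add x hx y hy]; abel
  g_add x hx y hy := by rw [p.g_add x hx y hy]; abel
  f_mul x hx r := by rw [p.f_mul x hx, neg_mul]
  g_mul r x hx := by rw [p.g_mul r x hx, mul_neg]
  balanced x hx y hy := by rw [mul_neg, neg_mul, p.balanced x hx y hy]

theorem mem_of_mem_sq_left {I J : TwoSidedIdeal R} {x : R} (hx : x ∈ idealSq (I ⊓ J)) :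
    x ∈ I := ((TwoSidedIdeal.mem_inf R).1 (idealSq_le _ hx)).1

theorem mem_of_mem_sq_right {I J : TwoSidedIdeal R} {x : R} (hx : x ∈ idealSq (I ⊓ J)) :
    x ∈ J := ((TwoSidedIdeal.mem_inf R).1 (idealSq_le _ hx)).2

theorem f_mem_left (p q : BalancedPair R) {x : R} (hx : x ∈ idealSq (p.J ⊓ q.J)) :
    q.f x ∈ p.J :=
  ((TwoSidedIdeal.mem_inf R).1
    (q.f_mem (I := p.J ⊓ q.J) (fun _ h => ((TwoSidedIdeal.mem_inf R).1 h).2) hx)).1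

theorem g_mem_right (p q : BalancedPair R) {x : R} (hx : x ∈ idealSq (p.J ⊓ q.J)) :
    p.g x ∈ q.J :=
  ((TwoSidedIdeal.mem_inf R).1
    (p.g_mem (I := p.J ⊓ q.J) (fun _ h => ((TwoSidedIdeal.mem_inf R).1 h).1) hx)).2

/-- Product: `(p q) x = p (q x)` and `x (p q) = (x p) q`, on the ideal `(J_p ∩ J_q)²`. -/
def mul (p q : BalancedPair R) : BalancedPair R where
  J := idealSq (p.J ⊓ q.J)
  J_ne_bot := idealSq_ne_bot (inf_ne_bot p.J_ne_bot q.J_ne_bot)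
  f x := p.f (q.f x)
  g x := q.g (p.g x)
  f_add x hx y hy := by
    rw [q.f_add x (mem_of_mem_sq_right hx) y (mem_of_mem_sq_right hy),
      p.f_add _ (f_mem_left p q hx) _ (f_mem_left p q hy)]
  g_add x hx y hy := by
    rw [p.g_add x (mem_of_mem_sq_left hx) y (mem_of_mem_sq_left hy),
      q.g_add _ (g_mem_right p q hx) _ (g_mem_right p q hy)]
  f_mul x hx r := by
    rw [q.f_mul x (mem_of_mem_sq_right hx), p.f_mul _ (f_mem_left p q hx)]
  g_mul r x hx := by
    rw [p.g_mul r x (mem_of_mem_sq_left hx), q.g_mul _ _ (g_mem_right p q hx)]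
  balanced x hx y hy := by
    rw [p.balanced x (mem_of_mem_sq_left hx) _ (f_mem_left p q hy),
      q.balanced _ (g_mem_right p q hx) y (mem_of_mem_sq_right hy)]

theorem add_congr {p p' q q' : BalancedPair R} (h : Equiv p p') (k : Equiv q q') :
    Equiv (add p q) (add p' q') := by
  obtain ⟨K, hK, h⟩ := h
  obtain ⟨L, hL, k⟩ := k
  refine ⟨K ⊓ L, inf_ne_bot hK hL, fun x hx => ?_⟩
  obtain ⟨hx1, hx2⟩ := (TwoSidedIdeal.mem_inf R).1 hx
  obtain ⟨h1, h2, h3, h4⟩ := h x hx1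
  obtain ⟨k1, k2, k3, k4⟩ := k x hx2
  exact ⟨(TwoSidedIdeal.mem_inf R).2 ⟨h1, k1⟩, (TwoSidedIdeal.mem_inf R).2 ⟨h2, k2⟩,
    congrArg₂ (· + ·) h3 k3, congrArg₂ (· + ·) h4 k4⟩

theorem neg_congr {p p' : BalancedPair R} (h : Equiv p p') : Equiv (neg p) (neg p') := by
  obtain ⟨K, hK, h⟩ := h
  refine ⟨K, hK, fun x hx => ?_⟩
  obtain ⟨h1, h2, h3, h4⟩ := h x hx
  exact ⟨h1, h2, congrArg (- ·) h3, congrArg (- ·) h4⟩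

theorem mul_congr {p p' q q' : BalancedPair R} (h : Equiv p p') (k : Equiv q q') :
    Equiv (mul p q) (mul p' q') := by
  obtain ⟨K, hK, h⟩ := h
  obtain ⟨L, hL, k⟩ := k
  refine ⟨idealSq (K ⊓ L) ⊓ ((mul p q).J ⊓ (mul p' q').J),
    inf_ne_bot (idealSq_ne_bot (inf_ne_bot hK hL))
      (inf_ne_bot (mul p q).J_ne_bot (mul p' q').J_ne_bot), fun x hx => ?_⟩
  obtain ⟨hx1, hx2⟩ := (TwoSidedIdeal.mem_inf R).1 hx
  obtain ⟨hx2, hx3⟩ := (TwoSidedIdeal.mem_inf R).1 hx2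
  have hf : q.f x ∈ K := ((TwoSidedIdeal.mem_inf R).1 (q.f_mem (I := K ⊓ L)
    (fun y hy => (k y ((TwoSidedIdeal.mem_inf R).1 hy).2).1) hx1)).1
  have hg : p.g x ∈ L := ((TwoSidedIdeal.mem_inf R).1 (p.g_mem (I := K ⊓ L)
    (fun y hy => (h y ((TwoSidedIdeal.mem_inf R).1 hy).1).1) hx1)).2
  refine ⟨hx2, hx3, ?_, ?_⟩
  · change p.f (q.f x) = p'.f (q'.f x)
    rw [← (k x (mem_of_mem_sq_right hx1)).2.2.1, (h _ hf).2.2.1]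
  · change q.g (p.g x) = q'.g (p'.g x)
    rw [← (h x (mem_of_mem_sq_left hx1)).2.2.2, (k _ hg).2.2.2]

end BalancedPair

/-- The symmetric Martindale ring of quotients `Q_s(R)` of a prime ring `R`: balanced pairs modulo
agreement on a nonzero ideal. -/
def SymmQuotientRing (R : Type*) [NonUnitalRing R] [IsPrimeRing R] : Type _ :=
  Quotient (BalancedPair.setoid R)

namespace SymmQuotientRing

open BalancedPair

variable {R : Type*} [NonUnitalRing R] [IsPrimeRing R]

instance : Zero (SymmQuotientRing R) := ⟨Quotient.mk _ (ofElement 0)⟩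
instance : One (SymmQuotientRing R) := ⟨Quotient.mk _ BalancedPair.one⟩
instance : Add (SymmQuotientRing R) :=
  ⟨Quotient.map₂ BalancedPair.add fun _ _ h _ _ k => add_congr h k⟩
instance : Neg (SymmQuotientRing R) := ⟨Quotient.map BalancedPair.neg fun _ _ h => neg_congr h⟩
instance : Mul (SymmQuotientRing R) :=
  ⟨Quotient.map₂ BalancedPair.mul fun _ _ h _ _ k => mul_congr h k⟩

instance : Ring (SymmQuotientRing R) where
  add_assoc := by
    rintro ⟨p⟩ ⟨q⟩ ⟨s⟩
    exact Quotient.sound (Equiv.of_forall fun x _ _ => ⟨add_assoc _ _ _, add_assoc _ _ _⟩)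
  zero_add := by
    rintro ⟨p⟩
    refine Quotient.sound (Equiv.of_forall fun x _ _ => ⟨?_, ?_⟩)
    · change 0 * x + p.f x = p.f x
      rw [zero_mul, zero_add]
    · change x * 0 + p.g x = p.g x
      rw [mul_zero, zero_add]
  add_zero := by
    rintro ⟨p⟩
    refine Quotient.sound (Equiv.of_forall fun x _ _ => ⟨?_, ?_⟩)
    · change p.f x + 0 * x = p.f x
      rw [zero_mul, add_zero]
    · change p.g x + x * 0 = p.g x
      rw [mul_zero, add_zero]
  add_comm := by
    rintro ⟨p⟩ ⟨q⟩
    exact Quotient.sound (Equiv.of_forall fun x _ _ => ⟨add_comm _ _, add_comm _ _⟩)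
  neg_add_cancel := by
    rintro ⟨p⟩
    refine Quotient.sound (Equiv.of_forall fun x _ _ => ⟨?_, ?_⟩)
    · change -p.f x + p.f x = 0 * x
      rw [zero_mul, neg_add_cancel]
    · change -p.g x + p.g x = x * 0
      rw [mul_zero, neg_add_cancel]
  mul_assoc := by
    rintro ⟨p⟩ ⟨q⟩ ⟨s⟩
    exact Quotient.sound (Equiv.of_forall fun x _ _ => ⟨rfl, rfl⟩)
  one_mul := by
    rintro ⟨p⟩
    exact Quotient.sound (Equiv.of_forall fun x _ _ => ⟨rfl, rfl⟩)
  mul_one := by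
    rintro ⟨p⟩
    exact Quotient.sound (Equiv.of_forall fun x _ _ => ⟨rfl, rfl⟩)
  zero_mul := by
    rintro ⟨p⟩
    refine Quotient.sound (Equiv.of_forall fun x _ _ => ⟨?_, ?_⟩)
    · change 0 * p.f x = 0 * x
      rw [zero_mul, zero_mul]
    · change p.g (x * 0) = x * 0
      rw [mul_zero, p.g_zero]
  mul_zero := by
    rintro ⟨p⟩
    refine Quotient.sound (Equiv.of_forall fun x _ _ => ⟨?_, ?_⟩)
    · change p.f (0 * x) = 0 * x
      rw [zero_mul, p.f_zero]
    · change p.g x * 0 = x * 0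
      rw [mul_zero, mul_zero]
  left_distrib := by
    rintro ⟨p⟩ ⟨q⟩ ⟨s⟩
    refine Quotient.sound (Equiv.of_forall fun x _ hx => ⟨?_, rfl⟩)
    obtain ⟨h1, h2⟩ := (TwoSidedIdeal.mem_inf R).1 hx
    exact p.f_add _ (f_mem_left p q h1) _ (f_mem_left p s h2)
  right_distrib := by
    rintro ⟨p⟩ ⟨q⟩ ⟨s⟩
    refine Quotient.sound (Equiv.of_forall fun x _ hx => ⟨rfl, ?_⟩)
    obtain ⟨h1, h2⟩ := (TwoSidedIdeal.mem_inf R).1 hx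
    exact s.g_add _ (g_mem_right p s h1) _ (g_mem_right q s h2)
  nsmul := nsmulRec
  zsmul := zsmulRec

/-- The canonical embedding of `R` into `Q_s(R)`. -/
def of (R : Type*) [NonUnitalRing R] [IsPrimeRing R] : R →ₙ+* SymmQuotientRing R where
  toFun r := Quotient.mk _ (ofElement r)
  map_zero' := rfl
  map_add' _ _ := Quotient.sound (Equiv.of_forall fun _ _ _ => ⟨add_mul _ _ _, mul_add _ _ _⟩)
  map_mul' _ _ := Quotient.sound
    (Equiv.of_forall fun _ _ _ => ⟨mul_assoc _ _ _, (mul_assoc _ _ _).symm⟩)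

end SymmQuotientRing

section Extended

variable (R : Type*) [NonUnitalRing R] [IsPrimeRing R]

/-- The extended centroid `C` of `R`: the center of `Q_s(R)`. -/
abbrev ExtendedCentroid : Subring (SymmQuotientRing R) :=
  Subring.center (SymmQuotientRing R)

variable {R} in
/-- `S C`, the `C`-subspace of `Q_s(R)` generated by a subset `S` of `R`. -/
def centroidSpan (S : Set R) : Submodule (ExtendedCentroid R) (SymmQuotientRing R) :=
  Submodule.span (ExtendedCentroid R) (SymmQuotientRing.of R '' S)

/-- A prime ring `R` is exceptional if `char R = 2` and `dim_C RC = 4`. -/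
def IsExceptional : Prop :=
  (∀ x : R, x + x = 0) ∧
    Module.finrank (ExtendedCentroid R) (centroidSpan (Set.univ : Set R)) = 4

end Extended

end PrimeRings

/-! Exceptionality makes `R` a spanning subring of a 2 by 2 matrix algebra over a field `K` of
characteristic 2. Indeed `RC` is finite-dimensional and prime, hence simple; it has a unit and
center `C`, so extending scalars to the algebraic closure of `C` splits it
(`exists_nonUnitalRingHom_matrix`).

In characteristic 2 the commutator of two traceless matrices is scalar. It is an alternating form on
the 3-dimensional space of traceless matrices, with radical the scalars. So a traceless matrix is
known modulo scalars from its commutators with two noncommuting traceless ones. Commutators in `R`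
are traceless, so this applies to them.

Suppose `A` contains noncommuting traceless `a`, `b`, and put `s = [a,b]`, a nonzero central
element. Every `c = [m,r]` satisfies `s c = α a + β b + γ` with `α = [c,b]`, `β = [a,c]` and `γ`
central. A further central factor `z s`, with `z ∈ I`, turns each summand into a commutator from
`[A,I]`, so `A` contains `z s² [R,R]`, which is a proper Lie ideal.

Otherwise the traceless elements of `A` commute with each other. A `b ∈ A` of nonzero trace would
give noncommuting traceless `[b,x]`, `[b,y]` in `A`, so all of `A` is traceless and commutative.
Then `A` lies in a maximal isotropic subspace of the form, which is `Ca + C`; a nonzero central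
`[a,u] ∈ A` supplies the constants, and Cayley–Hamilton makes `a²` central. -/

namespace PrimeRings

/-! ### Traceless 2 by 2 matrices in characteristic 2. -/

section TwoByTwo

open Matrix

/-- Tracelessness makes the two diagonal entries equal in characteristic 2, so the commutator is the
scalar `X 0 1 * Y 1 0 - Y 0 1 * X 1 0`. -/
theorem commute_lie_of_trace_eq_zero {K : Type*} [CommRing K] (h2 : (2 : K) = 0)
    {X Y : Matrix (Fin 2) (Fin 2) K} (hX : X.trace = 0) (hY : Y.trace = 0)
    (W : Matrix (Fin 2) (Fin 2) K) : W * ⁅X, Y⁆ = ⁅X, Y⁆ * W := by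
  rw [trace_fin_two] at hX hY
  have hX' : X 1 1 = X 0 0 := by linear_combination hX - X 0 0 * h2
  have hY' : Y 1 1 = Y 0 0 := by linear_combination hY - Y 0 0 * h2
  ext i j
  fin_cases i <;> fin_cases j <;>
    simp [Ring.lie_def, mul_apply, Fin.sum_univ_two, hX', hY'] <;>
    first
      | ring1
      | linear_combination (W 0 1 * (Y 0 1 * X 1 0 - X 0 1 * Y 1 0)) * h2
      | linear_combination (W 1 0 * (X 0 1 * Y 1 0 - Y 0 1 * X 1 0)) * h2

theorem commute_sq_of_trace_eq_zero {K : Type*} [CommRing K] {X : Matrix (Fin 2) (Fin 2) K}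
    (hX : X.trace = 0) (W : Matrix (Fin 2) (Fin 2) K) : W * (X * X) = X * X * W := by
  rw [trace_fin_two] at hX
  have hX' : X 1 1 = -X 0 0 := by linear_combination hX
  ext i j
  fin_cases i <;> fin_cases j <;> simp [mul_apply, Fin.sum_univ_two, hX'] <;> ring

/-- The commutator is the determinant of the off-diagonal parts. Those of `X` and `Y` are
independent, and that of `V` is parallel to both, so `V` is diagonal, hence scalar. -/
theorem commute_of_lie_eq_zero {K : Type*} [Field K] (h2 : (2 : K) = 0)
    {X Y V : Matrix (Fin 2) (Fin 2) K} (hX : X.trace = 0) (hY : Y.trace = 0) (hV : V.trace = 0)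
    (hXY : ⁅X, Y⁆ ≠ 0) (hXV : ⁅X, V⁆ = 0) (hYV : ⁅Y, V⁆ = 0)
    (W : Matrix (Fin 2) (Fin 2) K) : W * V = V * W := by
  rw [trace_fin_two] at hX hY hV
  have hX' : X 1 1 = X 0 0 := by linear_combination hX - X 0 0 * h2
  have hY' : Y 1 1 = Y 0 0 := by linear_combination hY - Y 0 0 * h2
  have hV' : V 1 1 = V 0 0 := by linear_combination hV - V 0 0 * h2
  have hd : X 0 1 * Y 1 0 - Y 0 1 * X 1 0 ≠ 0 := by
    intro hd
    apply hXY
    ext i j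
    fin_cases i <;> fin_cases j <;>
      simp [Ring.lie_def, mul_apply, Fin.sum_univ_two, hX', hY'] <;>
      first
        | ring1
        | linear_combination hd
        | linear_combination -hd
  have e1 : X 0 1 * V 1 0 - V 0 1 * X 1 0 = 0 := by
    have := congrFun (congrFun hXV 0) 0
    simp [Ring.lie_def, mul_apply, Fin.sum_univ_two] at this
    linear_combination this
  have e2 : Y 0 1 * V 1 0 - V 0 1 * Y 1 0 = 0 := by
    have := congrFun (congrFun hYV 0) 0
    simp [Ring.lie_def, mul_apply, Fin.sum_univ_two] at this
    linear_combination this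
  have v1 : V 0 1 = 0 := by
    refine (mul_eq_zero.1 (?_ : (X 0 1 * Y 1 0 - Y 0 1 * X 1 0) * V 0 1 = 0)).resolve_left hd
    linear_combination Y 0 1 * e1 - X 0 1 * e2
  have v2 : V 1 0 = 0 := by
    refine (mul_eq_zero.1 (?_ : (X 0 1 * Y 1 0 - Y 0 1 * X 1 0) * V 1 0 = 0)).resolve_left hd
    linear_combination Y 1 0 * e1 - X 1 0 * e2
  ext i j
  fin_cases i <;> fin_cases j <;>
    simp [mul_apply, Fin.sum_univ_two, hV', v1, v2] <;> ring

theorem trace_eq_zero_of_lie_lie_eq_zero {K : Type*} [Field K] (h2 : (2 : K) = 0)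
    {B : Matrix (Fin 2) (Fin 2) K}
    (h : ∀ X Y : Matrix (Fin 2) (Fin 2) K, ⁅⁅B, X⁆, ⁅B, Y⁆⁆ = 0) : B.trace = 0 := by
  have := congrFun (congrFun (h !![0, 1; 0, 0] !![0, 0; 1, 0]) 0) 0
  simp [Ring.lie_def, mul_apply, vecMul, dotProduct, Fin.sum_univ_two] at this
  -- For the two off-diagonal matrix units the corner entry is `-(B 0 0 - B 1 1)²`, which is the
  -- squared trace in characteristic 2.
  have h3 : (B 0 0 + B 1 1) * (B 0 0 + B 1 1) = 0 := by
    linear_combination (-1 : K) * this + 2 * B 0 0 * B 1 1 * h2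
  rw [trace_fin_two]
  exact mul_self_eq_zero.1 h3

theorem commute_of_lie_lie_eq_zero {K : Type*} [CommRing K] (h2 : (2 : K) = 0)
    {B : Matrix (Fin 2) (Fin 2) K} (hB : B.trace = 0)
    (h : ∀ X Y : Matrix (Fin 2) (Fin 2) K, ⁅B, ⁅X, Y⁆⁆ = 0)
    (W : Matrix (Fin 2) (Fin 2) K) : W * B = B * W := by
  rw [trace_fin_two] at hB
  have hB' : B 1 1 = B 0 0 := by linear_combination hB - B 0 0 * h2
  -- Both off-diagonal matrix units are commutators up to sign; commuting with them kills the
  -- off-diagonal entries of `B`.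
  have h1 := congrFun (congrFun (h !![1, 0; 0, 0] !![0, 1; 0, 0]) 0) 0
  have h3 := congrFun (congrFun (h !![1, 0; 0, 0] !![0, 0; 1, 0]) 0) 0
  simp [Ring.lie_def, mul_apply, vecMul, dotProduct, Fin.sum_univ_two] at h1 h3
  ext i j
  fin_cases i <;> fin_cases j <;>
    simp [mul_apply, Fin.sum_univ_two, hB', h1, h3] <;> ring

end TwoByTwo

/-! ### Passing from a spanning set to the whole algebra. -/

section Span

variable {K V : Type*} [CommRing K] [Ring V] [Algebra K V] {S : Set V}

theorem lie_lie_eq_zero_of_span_eq_top (hS : Submodule.span K S = ⊤) {b : V}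
    (h : ∀ x ∈ S, ∀ y ∈ S, ⁅⁅b, x⁆, ⁅b, y⁆⁆ = 0) (x y : V) : ⁅⁅b, x⁆, ⁅b, y⁆⁆ = 0 := by
  have hx : x ∈ Submodule.span K S := hS ▸ Submodule.mem_top
  have hy : y ∈ Submodule.span K S := hS ▸ Submodule.mem_top
  simp only [Ring.lie_def] at h ⊢
  induction hx, hy using Submodule.span_induction₂ with
  | mem_mem x y hx hy => exact h x hx y hy
  | zero_left | zero_right => simp
  | add_left x y z _ _ _ h1 h2 | add_right x y z _ _ _ h1 h2 =>
    -- Additivity in each argument: the target `0` is split into two zeros, replaced by the two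
    -- inductive expressions.
    rw [← add_zero (0 : V)]
    nth_rewrite 1 [← h1]
    rw [← h2]
    noncomm_ring
  | smul_left k x y _ _ h | smul_right k x y _ _ h =>
    simpa [← smul_sub] using congrArg (k • ·) h

theorem lie_lie_right_eq_zero_of_span_eq_top (hS : Submodule.span K S = ⊤) {b : V}
    (h : ∀ x ∈ S, ∀ y ∈ S, ⁅b, ⁅x, y⁆⁆ = 0) (x y : V) : ⁅b, ⁅x, y⁆⁆ = 0 := by
  have hx : x ∈ Submodule.span K S := hS ▸ Submodule.mem_top
  have hy : y ∈ Submodule.span K S := hS ▸ Submodule.mem_top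
  simp only [Ring.lie_def] at h ⊢
  induction hx, hy using Submodule.span_induction₂ with
  | mem_mem x y hx hy => exact h x hx y hy
  | zero_left | zero_right => simp
  | add_left x y z _ _ _ h1 h2 | add_right x y z _ _ _ h1 h2 =>
    rw [← add_zero (0 : V)]
    nth_rewrite 1 [← h1]
    rw [← h2]
    noncomm_ring
  | smul_left k x y _ _ h | smul_right k x y _ _ h =>
    simpa [← smul_sub] using congrArg (k • ·) h

/-- The image of a nonzero ideal spans a simple algebra that is spanned by the image of the
ring. -/
theorem span_image_ideal_eq_top [IsSimpleRing V] {R : Type*} [NonUnitalRing R] (φ : R →ₙ+* V)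
    (hφ : Function.Injective φ) (hspan : Submodule.span K (Set.range φ) = ⊤)
    {I : TwoSidedIdeal R} (hI : I ≠ ⊥) :
    Submodule.span K (φ '' (I : Set R)) = ⊤ := by
  set W := Submodule.span K (φ '' (I : Set R)) with hW
  have left : ∀ {x y : V}, y ∈ W → x * y ∈ W := by
    intro x y hy
    have hx : x ∈ Submodule.span K (Set.range φ) := hspan ▸ Submodule.mem_top
    have := Submodule.mul_mem_mul hx hy
    rw [hW, Submodule.span_mul_span] at this
    refine Submodule.span_mono ?_ this
    rintro _ ⟨_, ⟨r, rfl⟩, _, ⟨i, hi, rfl⟩, rfl⟩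
    exact ⟨r * i, I.mul_mem_left _ _ hi, map_mul _ _ _⟩
  have right : ∀ {x y : V}, x ∈ W → x * y ∈ W := by
    intro x y hx
    have hy : y ∈ Submodule.span K (Set.range φ) := hspan ▸ Submodule.mem_top
    have := Submodule.mul_mem_mul hx hy
    rw [hW, Submodule.span_mul_span] at this
    refine Submodule.span_mono ?_ this
    rintro _ ⟨_, ⟨i, hi, rfl⟩, _, ⟨r, rfl⟩, rfl⟩
    exact ⟨i * r, I.mul_mem_right _ _ hi, map_mul _ _ _⟩
  obtain ⟨x, hx, hx0⟩ := exists_ne_zero_of_ne_bot hI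
  -- The span is closed under multiplication by the span of the ring, so it is a nonzero two-sided
  -- ideal of a simple ring.
  have h1 : (1 : V) ∈ TwoSidedIdeal.mk' (W : Set V) W.zero_mem W.add_mem W.neg_mem left right :=
    IsSimpleRing.one_mem_of_ne_zero_mem _ (x := φ x) ((map_ne_zero_iff φ hφ).2 hx0)
      ((TwoSidedIdeal.mem_mk' _ _ _ _ _ _ _).2 (Submodule.subset_span ⟨x, hx, rfl⟩))
  rw [TwoSidedIdeal.mem_mk'] at h1
  exact eq_top_iff.2 fun y _ => mul_one y ▸ left h1

end Span

end PrimeRings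

namespace PrimeRings

/-! ### Central elements and the ideals they generate. -/

section CentralElements

variable {R : Type*} [NonUnitalRing R]

theorem lie_mul_of_mem_center {t : R} (ht : t ∈ Set.center R) (x y : R) :
    ⁅x, t * y⁆ = t * ⁅x, y⁆ := by
  rw [Semigroup.mem_center_iff] at ht
  rw [Ring.lie_def, Ring.lie_def, ← mul_assoc, ht, mul_assoc, mul_assoc, ← mul_sub]

theorem lie_mul_self (x y : R) : ⁅x, y * x⁆ = ⁅x, y⁆ * x := by
  simp only [Ring.lie_def, sub_mul, mul_assoc]

theorem lie_swap (x y : R) : ⁅y, x⁆ = -⁅x, y⁆ := by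
  simp only [Ring.lie_def, neg_sub]

theorem lie_mem_ideal (I : TwoSidedIdeal R) (x : R) {y : R} (hy : y ∈ I) : ⁅x, y⁆ ∈ I := by
  rw [Ring.lie_def]
  exact sub_mem (I.mul_mem_left _ _ hy) (I.mul_mem_right _ _ hy)

theorem mul_mem_center {s t : R} (hs : s ∈ Set.center R) (ht : t ∈ Set.center R) :
    s * t ∈ Set.center R :=
  Set.mul_mem_center hs ht

theorem mul_ne_zero_of_mem_center [IsPrimeRing R] {t x : R} (ht : t ∈ Set.center R)
    (ht0 : t ≠ 0) (hx : x ≠ 0) : t * x ≠ 0 := by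
  intro h
  rw [Semigroup.mem_center_iff] at ht
  rcases IsPrimeRing.eq_zero_or_eq_zero t x fun r => by rw [← ht, mul_assoc, h, mul_zero]
    with h | h <;> contradiction

/-- The ideal `t R` for a central element `t`. -/
def centralMulIdeal (t : R) (ht : t ∈ Set.center R) : TwoSidedIdeal R :=
  TwoSidedIdeal.mk' (Set.range (t * ·)) ⟨0, mul_zero t⟩
    (by rintro _ _ ⟨x, rfl⟩ ⟨y, rfl⟩; exact ⟨x + y, mul_add _ _ _⟩)
    (by rintro _ ⟨x, rfl⟩; exact ⟨-x, mul_neg _ _⟩)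
    (by
      rintro r _ ⟨x, rfl⟩
      refine ⟨r * x, ?_⟩
      change t * (r * x) = r * (t * x)
      rw [← mul_assoc, ← mul_assoc, Semigroup.mem_center_iff.1 ht])
    (by rintro _ r ⟨x, rfl⟩; exact ⟨x * r, (mul_assoc _ _ _).symm⟩)

theorem mem_centralMulIdeal {t : R} {ht : t ∈ Set.center R} {x : R} :
    x ∈ centralMulIdeal t ht ↔ ∃ r, t * r = x :=
  TwoSidedIdeal.mem_mk' _ _ _ _ _ _ _

/-- Since `t` is central, `[tR, R] = t[R, R]`. -/
theorem exists_isProperLieIdeal_le_of_central_mul [IsPrimeRing R] {A : AddSubgroup R} {t : R}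
    (ht : t ∈ Set.center R) (ht0 : t ≠ 0) (h : ∀ m r : R, t * ⁅m, r⁆ ∈ A) :
    ∃ L : AddSubgroup R, IsProperLieIdeal L ∧ L ≤ A := by
  refine ⟨_, ⟨centralMulIdeal t ht, ?_, rfl⟩, ?_⟩
  -- Without a unit, `t` itself need not lie in `tR`; the nonzero element used is `t * t`.
  · exact ne_bot_of_mem (mem_centralMulIdeal.2 ⟨t, rfl⟩) (mul_ne_zero_of_mem_center ht ht0 ht0)
  · refine (AddSubgroup.closure_le _).2 ?_
    rintro _ ⟨x, hx, r, -, rfl⟩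
    obtain ⟨m, rfl⟩ := mem_centralMulIdeal.1 hx
    have := h m r
    rwa [Ring.lie_def, mul_sub, ← mul_assoc, ← mul_assoc, ← Semigroup.mem_center_iff.1 ht r,
      mul_assoc r t m] at this

end CentralElements

/-! ### The dichotomy inside a spanning subring of 2 by 2 matrices. -/

section LieAbsorbing

open Matrix

variable {R : Type*} [NonUnitalRing R] {K : Type*} [Field K]
  {φ : R →ₙ+* Matrix (Fin 2) (Fin 2) K}

theorem map_lie (x y : R) : φ ⁅x, y⁆ = ⁅φ x, φ y⁆ := by
  simp only [Ring.lie_def, map_sub, map_mul]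

theorem trace_map_lie (x y : R) : (φ ⁅x, y⁆).trace = 0 := by
  rw [map_lie, Ring.lie_def, trace_sub, trace_mul_comm, sub_self]

theorem two_eq_zero_of_span_eq_top (hspan : Submodule.span K (Set.range φ) = ⊤)
    (hR : ∀ x : R, x + x = 0) : (2 : K) = 0 := by
  have key : ∀ X : Matrix (Fin 2) (Fin 2) K, X + X = 0 := by
    intro X
    have hX : X ∈ Submodule.span K (Set.range φ) := hspan ▸ Submodule.mem_top
    induction hX using Submodule.span_induction with
    | mem x hx =>
      obtain ⟨r, rfl⟩ := hx
      rw [← map_add, hR, map_zero]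
    | zero => simp
    | add x y _ _ h1 h2 => rw [add_add_add_comm, h1, h2, add_zero]
    | smul k x _ h => rw [← smul_add, h, smul_zero]
  have := congrFun (congrFun (key 1) 0) 0
  simpa [one_add_one_eq_two] using this

theorem mem_center_of_map (hφ : Function.Injective φ) {z : R}
    (h : ∀ W, W * φ z = φ z * W) : z ∈ Set.center R :=
  Semigroup.mem_center_iff.2 fun r => hφ (by rw [map_mul, map_mul, h])

theorem map_commute_of_mem_center (hspan : Submodule.span K (Set.range φ) = ⊤) {z : R}
    (hz : z ∈ Set.center R) (W : Matrix (Fin 2) (Fin 2) K) : W * φ z = φ z * W := by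
  have hW : W ∈ Submodule.span K (Set.range φ) := hspan ▸ Submodule.mem_top
  induction hW using Submodule.span_induction with
  | mem x hx =>
    obtain ⟨r, rfl⟩ := hx
    rw [← map_mul, ← map_mul, Semigroup.mem_center_iff.1 hz]
  | zero => simp
  | add x y _ _ h1 h2 => rw [add_mul, mul_add, h1, h2]
  | smul k x _ h => rw [smul_mul_assoc, mul_smul_comm, h]

theorem trace_map_mul_of_mem_center (hspan : Submodule.span K (Set.range φ) = ⊤) {z x : R}
    (hz : z ∈ Set.center R) (hx : (φ x).trace = 0) : (φ (z * x)).trace = 0 := by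
  obtain ⟨k, hk⟩ : ∃ k : K, φ z = k • 1 := by
    have : φ z ∈ Set.center _ :=
      Semigroup.mem_center_iff.2 (map_commute_of_mem_center hspan hz)
    rw [Matrix.center_eq_range] at this
    obtain ⟨k, hk⟩ := this
    exact ⟨k, by rw [← hk, scalar_apply, smul_one_eq_diagonal]⟩
  rw [map_mul, hk, smul_mul_assoc, one_mul, trace_smul, hx, smul_zero]

variable (hφ : Function.Injective φ) (hspan : Submodule.span K (Set.range φ) = ⊤)
  (hR : ∀ x : R, x + x = 0)

include hφ hspan hR

theorem lie_mem_center_of_trace {a b : R} (ha : (φ a).trace = 0) (hb : (φ b).trace = 0) :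
    ⁅a, b⁆ ∈ Set.center R :=
  mem_center_of_map hφ fun W => by
    rw [map_lie, commute_lie_of_trace_eq_zero (two_eq_zero_of_span_eq_top hspan hR) ha hb]

theorem mem_center_of_lie_eq_zero {a b v : R} (ha : (φ a).trace = 0) (hb : (φ b).trace = 0)
    (hv : (φ v).trace = 0) (hab : ⁅a, b⁆ ≠ 0) (hav : ⁅a, v⁆ = 0) (hbv : ⁅b, v⁆ = 0) :
    v ∈ Set.center R := by
  refine mem_center_of_map hφ (commute_of_lie_eq_zero (two_eq_zero_of_span_eq_top hspan hR)
    ha hb hv ?_ ?_ ?_)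
  · rw [← map_lie]; exact (map_ne_zero_iff φ hφ).2 hab
  · rw [← map_lie, hav, map_zero]
  · rw [← map_lie, hbv, map_zero]

/-- The image of `I` spans all matrices, so by bilinearity vanishing on `I` would persist for all
matrices and force trace zero. -/
theorem exists_lie_lie_ne_zero {I : TwoSidedIdeal R} (hI : I ≠ ⊥) {b : R}
    (hb : (φ b).trace ≠ 0) : ∃ x ∈ I, ∃ y ∈ I, ⁅⁅b, x⁆, ⁅b, y⁆⁆ ≠ 0 := by
  by_contra! h
  refine hb (trace_eq_zero_of_lie_lie_eq_zero (two_eq_zero_of_span_eq_top hspan hR)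
    (lie_lie_eq_zero_of_span_eq_top (span_image_ideal_eq_top φ hφ hspan hI) ?_))
  rintro _ ⟨x, hx, rfl⟩ _ ⟨y, hy, rfl⟩
  rw [← map_lie, ← map_lie, ← map_lie, h x hx y hy, map_zero]

theorem exists_lie_lie_right_ne_zero {I : TwoSidedIdeal R} (hI : I ≠ ⊥) {a : R}
    (ha : (φ a).trace = 0) (hac : a ∉ Set.center R) :
    ∃ x ∈ I, ∃ y ∈ I, ⁅a, ⁅x, y⁆⁆ ≠ 0 := by
  by_contra! h
  refine hac (mem_center_of_map hφ (commute_of_lie_lie_eq_zero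
    (two_eq_zero_of_span_eq_top hspan hR) ha
    (lie_lie_right_eq_zero_of_span_eq_top (span_image_ideal_eq_top φ hφ hspan hI) ?_)))
  rintro _ ⟨x, hx, rfl⟩ _ ⟨y, hy, rfl⟩
  rw [← map_lie, ← map_lie, h x hx y hy, map_zero]

/-- The trace is nonzero on the spanning set `I`, and a commutator of two commutators is central. -/
theorem exists_mem_ideal_mem_center {I : TwoSidedIdeal R} (hI : I ≠ ⊥) :
    ∃ z ∈ I, z ∈ Set.center R ∧ z ≠ 0 := by
  obtain ⟨b, hb, htr⟩ : ∃ b ∈ I, (φ b).trace ≠ 0 := by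
    by_contra! h
    have hs := span_image_ideal_eq_top φ hφ hspan hI
    have : traceLinearMap (Fin 2) K K = 0 := by
      refine LinearMap.ext_on hs ?_
      rintro _ ⟨x, hx, rfl⟩
      exact h x hx
    have := LinearMap.congr_fun this !![1, 0; 0, 0]
    simp [trace_fin_two] at this
  obtain ⟨x, hx, y, hy, h0⟩ := exists_lie_lie_ne_zero hφ hspan hR hI htr
  exact ⟨_, lie_mem_ideal I _ (lie_mem_ideal I _ hy), lie_mem_center_of_trace hφ hspan hR
    (trace_map_lie _ _) (trace_map_lie _ _), h0⟩

/-- If `A` absorbs commutators with `I` and has two noncommuting elements of trace zero, then it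
contains a proper Lie ideal. -/
theorem exists_isProperLieIdeal_le_of_lie_ne_zero [IsPrimeRing R] {A : AddSubgroup R}
    {I : TwoSidedIdeal R} (hI : I ≠ ⊥) (hAI : ∀ a ∈ A, ∀ x ∈ I, ⁅a, x⁆ ∈ A) {a b : R}
    (ha : a ∈ A) (hb : b ∈ A) (hta : (φ a).trace = 0) (htb : (φ b).trace = 0)
    (hab : ⁅a, b⁆ ≠ 0) : ∃ L : AddSubgroup R, IsProperLieIdeal L ∧ L ≤ A := by
  obtain ⟨z, hzI, hz, hz0⟩ := exists_mem_ideal_mem_center hφ hspan hR hI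
  have hs := lie_mem_center_of_trace hφ hspan hR hta htb
  set s := ⁅a, b⁆ with hs_def
  have hscomm := Semigroup.mem_center_iff.1 hs
  -- One factor `s` clears the denominator in the expansion of `c`, the other makes each summand a
  -- commutator, and `z` puts the second entries in `I`.
  refine exists_isProperLieIdeal_le_of_central_mul (t := z * s * s)
    (mul_mem_center (mul_mem_center hz hs) hs)
    (by
      rw [mul_assoc]
      exact mul_ne_zero_of_mem_center hz hz0 (mul_ne_zero_of_mem_center hs hab hab)) ?_
  intro m r
  have hα := lie_mem_center_of_trace hφ hspan hR (trace_map_lie (φ := φ) m r) htb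
  have hβ := lie_mem_center_of_trace hφ hspan hR hta (trace_map_lie (φ := φ) m r)
  have htc := trace_map_lie (φ := φ) m r
  set c := ⁅m, r⁆
  set α := ⁅c, b⁆ with hα_def
  set β := ⁅a, c⁆ with hβ_def
  have hαcomm := Semigroup.mem_center_iff.1 hα
  have hβcomm := Semigroup.mem_center_iff.1 hβ
  -- The coefficients `α`, `β` are chosen so that the remainder commutes with `a` and `b`.
  have hγ : s * c - α * a - β * b ∈ Set.center R := by
    refine mem_center_of_lie_eq_zero hφ hspan hR hta htb ?_ hab ?_ ?_
    · rw [map_sub, map_sub, trace_sub, trace_sub, trace_map_mul_of_mem_center hspan hs htc,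
        trace_map_mul_of_mem_center hspan hα hta, trace_map_mul_of_mem_center hspan hβ htb]
      simp
    · have : ⁅a, s * c - α * a - β * b⁆ = ⁅a, s * c⁆ - ⁅a, α * a⁆ - ⁅a, β * b⁆ := by
        simp only [Ring.lie_def]; noncomm_ring
      rw [this, lie_mul_of_mem_center hs, lie_mul_of_mem_center hα, lie_mul_of_mem_center hβ,
        ← hs_def, ← hβ_def, hβcomm, Ring.lie_def a a]
      simp
    · have : ⁅b, s * c - α * a - β * b⁆ = ⁅b, s * c⁆ - ⁅b, α * a⁆ - ⁅b, β * b⁆ := by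
        simp only [Ring.lie_def]; noncomm_ring
      rw [this, lie_mul_of_mem_center hs, lie_mul_of_mem_center hα, lie_mul_of_mem_center hβ,
        lie_swap c b, lie_swap a b, ← hs_def, ← hα_def, Ring.lie_def b b, mul_neg,
        hαcomm]
      simp
  set γ := s * c - α * a - β * b with hγ_def
  have e1 : ⁅a, z * α * (b * a)⁆ = z * s * (α * a) := by
    rw [lie_mul_of_mem_center (mul_mem_center hz hα), lie_mul_self, ← hs_def]
    rw [mul_assoc, ← mul_assoc α, hscomm α]
    simp only [mul_assoc]
  have e2 : ⁅b, z * β * (a * b)⁆ = -(z * s * (β * b)) := by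
    rw [lie_mul_of_mem_center (mul_mem_center hz hβ), lie_mul_self, lie_swap a b, ← hs_def]
    rw [mul_assoc, neg_mul, mul_neg, mul_neg, ← mul_assoc β, hscomm β]
    simp only [mul_assoc]
  have e3 : ⁅a, z * γ * b⁆ = z * s * γ := by
    rw [lie_mul_of_mem_center (mul_mem_center hz hγ), ← hs_def, mul_assoc, hscomm γ, mul_assoc]
  have e : z * s * s * c = ⁅a, z * α * (b * a)⁆ - ⁅b, z * β * (a * b)⁆ + ⁅a, z * γ * b⁆ := by
    rw [e1, e2, e3, hγ_def]
    noncomm_ring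
  rw [e]
  refine add_mem (sub_mem (hAI a ha _ ?_) (hAI b hb _ ?_)) (hAI a ha _ ?_) <;>
  exact I.mul_mem_right _ _ (I.mul_mem_right _ _ hzI)

/-- The alternative for additive subgroups absorbing commutators with a nonzero ideal. -/
theorem exists_isProperLieIdeal_le_or [IsPrimeRing R] {A : AddSubgroup R}
    (hA : ¬ ((A : Set R) ⊆ Set.center R)) {I : TwoSidedIdeal R} (hI : I ≠ ⊥)
    (hAI : ∀ a ∈ A, ∀ x ∈ I, ⁅a, x⁆ ∈ A) :
    (∃ L : AddSubgroup R, IsProperLieIdeal L ∧ L ≤ A) ∨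
    ∃ a ∈ A, a ∉ Set.center R ∧ a * a ∈ Set.center R ∧
      ∃ l ∈ A, l ∈ Set.center R ∧ l ≠ 0 ∧
        ∀ b ∈ A, ∃ m ∈ Set.center R, ∃ v ∈ Set.center R, l * b = m * a + v := by
  by_cases hcase : ∃ a ∈ A, ∃ b ∈ A, (φ a).trace = 0 ∧ (φ b).trace = 0 ∧ ⁅a, b⁆ ≠ 0
  · obtain ⟨a, ha, b, hb, hta, htb, hab⟩ := hcase
    exact Or.inl
      (exists_isProperLieIdeal_le_of_lie_ne_zero hφ hspan hR hI hAI ha hb hta htb hab)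
  right
  push Not at hcase
  -- From here on, any two traceless elements of `A` commute; an element of nonzero trace would
  -- produce a noncommuting pair of commutators in `A`.
  have htr : ∀ b ∈ A, (φ b).trace = 0 := by
    intro b hb
    by_contra htb
    obtain ⟨x, hx, y, hy, h⟩ := exists_lie_lie_ne_zero hφ hspan hR hI htb
    exact h (hcase _ (hAI b hb x hx) _ (hAI b hb y hy) (trace_map_lie _ _) (trace_map_lie _ _))
  obtain ⟨a, ha, hac⟩ := Set.not_subset.1 hA
  obtain ⟨x, hx, y, hy, h0⟩ := exists_lie_lie_right_ne_zero hφ hspan hR hI (htr a ha) hac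
  have htu := trace_map_lie (φ := φ) x y
  have huI : ⁅x, y⁆ ∈ I := lie_mem_ideal I x hy
  set u := ⁅x, y⁆
  have hl := lie_mem_center_of_trace hφ hspan hR (htr a ha) htu
  refine ⟨a, ha, hac, mem_center_of_map hφ fun W => ?_, ⁅a, u⁆, hAI a ha u huI, hl, h0, ?_⟩
  · rw [map_mul, commute_sq_of_trace_eq_zero (htr a ha)]
  intro b hb
  have hm := lie_mem_center_of_trace hφ hspan hR (htr b hb) htu
  -- The remainder commutes with `a` because `b` does, and with `u` by the choice of coefficients;
  -- `a` and `u` do not commute, so it is central.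
  refine ⟨⁅b, u⁆, hm, ⁅a, u⁆ * b - ⁅b, u⁆ * a, ?_, by abel⟩
  refine mem_center_of_lie_eq_zero hφ hspan hR (htr a ha) htu ?_ h0 ?_ ?_
  · rw [map_sub, trace_sub, trace_map_mul_of_mem_center hspan hl (htr b hb),
      trace_map_mul_of_mem_center hspan hm (htr a ha), sub_zero]
  · have : ⁅a, ⁅a, u⁆ * b - ⁅b, u⁆ * a⁆ = ⁅a, ⁅a, u⁆ * b⁆ - ⁅a, ⁅b, u⁆ * a⁆ := by
      rw [Ring.lie_def, Ring.lie_def a (_ * b), Ring.lie_def a (_ * a)]; noncomm_ring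
    rw [this, lie_mul_of_mem_center hl, lie_mul_of_mem_center hm,
      hcase a ha b hb (htr a ha) (htr b hb), Ring.lie_def a a]
    simp
  · have : ⁅u, ⁅a, u⁆ * b - ⁅b, u⁆ * a⁆ = ⁅u, ⁅a, u⁆ * b⁆ - ⁅u, ⁅b, u⁆ * a⁆ := by
      rw [Ring.lie_def, Ring.lie_def u (_ * b), Ring.lie_def u (_ * a)]; noncomm_ring
    rw [this, lie_mul_of_mem_center hl, lie_mul_of_mem_center hm, lie_swap b u,
      lie_swap a u, mul_neg, mul_neg, Semigroup.mem_center_iff.1 hm]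
    simp

end LieAbsorbing

end PrimeRings

namespace PrimeRings

/-! ### Splitting a four-dimensional prime algebra. -/

section SimpleAlgebra

open TensorProduct

universe u

/-- An Artinian ring that is prime is simple. -/
theorem isSimpleRing_of_isArtinianRing {Q : Type*} [Ring Q] [Nontrivial Q] [IsArtinianRing Q]
    (hprime : ∀ a b : Q, (∀ x, a * x * b = 0) → a = 0 ∨ b = 0) : IsSimpleRing Q := by
  have hnil : IsNilpotent (Ring.jacobson Q) := IsSemiprimaryRing.isNilpotent
  have hjac : Ring.jacobson Q = ⊥ := by
    by_contra hJ
    -- The last nonzero power of the radical `J` is annihilated by `J`: `J ^ k * Q * J = 0`, against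
    -- primeness.
    obtain ⟨k, h1, h2⟩ : ∃ k, Ring.jacobson Q ^ (k + 1) = 0 ∧ Ring.jacobson Q ^ k ≠ 0 := by
      by_contra! h
      obtain ⟨n, hn⟩ := hnil
      induction n with
      | zero =>
        rw [Submodule.pow_zero, Ideal.one_eq_top] at hn
        exact _root_.top_ne_bot hn
      | succ n ih => exact ih (h n hn)
    obtain ⟨b, hb, hb0⟩ := Submodule.exists_mem_ne_zero_of_ne_bot hJ
    obtain ⟨a, ha, ha0⟩ := Submodule.exists_mem_ne_zero_of_ne_bot h2
    refine (hprime a b fun x => ?_).elim ha0 hb0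
    have : a * (x * b) ∈ Ring.jacobson Q ^ (k + 1) := by
      rw [Submodule.pow_succ]
      exact Ideal.mul_mem_mul ha (Ideal.mul_mem_left _ _ hb)
    rw [h1] at this
    rw [mul_assoc]
    exact this
  have hss : IsSemisimpleRing Q := IsArtinianRing.isSemisimpleRing_iff_jacobson.2 hjac
  refine isSimpleRing_iff_isTwoSided_imp.2 ⟨inferInstance,
    fun N hN => or_iff_not_imp_left.2 fun hN0 => ?_⟩
  obtain ⟨e, he, rfl⟩ := IsSemisimpleRing.ideal_eq_span_idempotent N
  have heN : e ∈ Ideal.span {e} := Ideal.mem_span_singleton_self e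
  have he0 : e ≠ 0 := by
    rintro rfl
    exact hN0 (by simp)
  -- The two-sided ideal is `Qe`, so `e x ∈ Qe` and `e x (1 - e) = 0` for every `x`.
  have h1 : 1 - e = 0 := by
    refine (hprime e (1 - e) fun x => ?_).resolve_left he0
    obtain ⟨y, hy⟩ := Ideal.mem_span_singleton'.1 (Ideal.mul_mem_right x _ heN)
    rw [← hy, mul_assoc, mul_sub, mul_one, he.eq, sub_self, mul_zero]
  rw [sub_eq_zero] at h1
  rw [Ideal.eq_top_iff_one, h1]
  simp

/-- The scalar extension of a central simple algebra is simple. -/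
theorem isSimpleRing_tensorProduct {C K Q : Type*} [Field C] [Field K] [Algebra C K] [Ring Q]
    [Algebra C Q] [IsSimpleRing Q]
    (hcentral : ∀ z : Q, (∀ x, x * z = z * x) → ∃ c, algebraMap C Q c = z) :
    IsSimpleRing (Q ⊗[C] K) := by
  classical
  let B := Module.Basis.ofVectorSpace C K
  let b := Algebra.TensorProduct.basis Q B
  refine IsSimpleRing.of_eq_bot_or_eq_top fun N => or_iff_not_imp_left.2 fun hN => ?_
  have hcoord (i) (q r : Q) (u : Q ⊗[C] K) :
      b.repr ((q ⊗ₜ 1) * u * (r ⊗ₜ 1)) i = q * b.repr u i * r := by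
    induction u with
    | zero => simp
    | add u v hu hv => simp [mul_add, add_mul, hu, hv]
    | tmul s k =>
      simp [b, Algebra.TensorProduct.basis_repr_tmul, mul_assoc, Algebra.commutes]
  -- Shortest element argument: `u` has the fewest nonzero coordinates, taken in `Q` along a
  -- `C`-basis of `K`.
  obtain ⟨u, ⟨huN, hu0⟩, hmin⟩ := WellFounded.has_min
    (InvImage.wf (fun u : Q ⊗[C] K => (b.repr u).support.card) wellFounded_lt)
    {u | u ∈ N ∧ u ≠ 0} (exists_ne_zero_of_ne_bot hN)
  obtain ⟨i, hi⟩ : ∃ i, b.repr u i ≠ 0 := by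
    by_contra! h
    exact hu0 (b.repr.map_eq_zero_iff.1 (Finsupp.ext h))
  let P : TwoSidedIdeal Q := TwoSidedIdeal.mk'
    {q | ∃ v ∈ N, (b.repr v).support ⊆ (b.repr u).support ∧ b.repr v i = q}
    ⟨0, zero_mem _, by simp, by simp⟩
    (by
      rintro _ _ ⟨v, hv, hv', rfl⟩ ⟨w, hw, hw', rfl⟩
      refine ⟨v + w, add_mem hv hw, ?_, by simp⟩
      rw [map_add]
      exact Finsupp.support_add.trans (Finset.union_subset hv' hw'))
    (by
      rintro _ ⟨v, hv, hv', rfl⟩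
      exact ⟨-v, neg_mem hv, by simpa using hv', by simp⟩)
    (by
      rintro q _ ⟨v, hv, hv', rfl⟩
      refine ⟨(q ⊗ₜ 1) * v * (1 ⊗ₜ 1), N.mul_mem_right _ _ (N.mul_mem_left _ _ hv), ?_, ?_⟩
      · intro j hj
        rw [Finsupp.mem_support_iff, hcoord, mul_one] at hj
        exact hv' (Finsupp.mem_support_iff.2 (right_ne_zero_of_mul hj))
      · rw [hcoord, mul_one])
    (by
      rintro _ q ⟨v, hv, hv', rfl⟩
      refine ⟨(1 ⊗ₜ 1) * v * (q ⊗ₜ 1), N.mul_mem_right _ _ (N.mul_mem_left _ _ hv), ?_, ?_⟩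
      · intro j hj
        rw [Finsupp.mem_support_iff, hcoord, one_mul] at hj
        exact hv' (Finsupp.mem_support_iff.2 (left_ne_zero_of_mul hj))
      · rw [hcoord, one_mul])
  have h1 : (1 : Q) ∈ P := IsSimpleRing.one_mem_of_ne_zero_mem _ hi
    ((TwoSidedIdeal.mem_mk' _ _ _ _ _ _ _).2 ⟨u, huN, subset_rfl, rfl⟩)
  obtain ⟨v, hvN, hvu, hvi⟩ := (TwoSidedIdeal.mem_mk' _ _ _ _ _ _ _).1 h1
  -- The `i`-th coordinate of `v` is 1, so it cancels here and the support is strictly smaller than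
  -- that of `u`. Hence all coordinates of `v` are central, and `v` is a unit `1 ⊗ k`.
  have hv (q : Q) : (q ⊗ₜ[C] (1 : K)) * v * (1 ⊗ₜ 1) - (1 ⊗ₜ 1) * v * (q ⊗ₜ 1) = 0 := by
    by_contra h0
    refine hmin _ ⟨sub_mem (N.mul_mem_right _ _ (N.mul_mem_left _ _ hvN))
      (N.mul_mem_right _ _ (N.mul_mem_left _ _ hvN)), h0⟩ (Finset.card_lt_card ?_)
    refine (Finset.ssubset_iff_of_subset fun j hj => hvu ?_).2
      ⟨i, Finsupp.mem_support_iff.2 hi, ?_⟩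
    · rw [Finsupp.mem_support_iff, map_sub, Finsupp.sub_apply, hcoord, hcoord] at hj
      rw [Finsupp.mem_support_iff]
      intro hj0
      simp [hj0] at hj
    · rw [Finsupp.mem_support_iff, map_sub, Finsupp.sub_apply, hcoord, hcoord, hvi]
      simp
  have hcen (j) : ∃ c, algebraMap C Q c = b.repr v j := by
    refine hcentral _ fun q => ?_
    have := congrArg (fun w => b.repr w j) (hv q)
    simpa [hcoord, sub_eq_zero] using this
  choose c hc using hcen
  have hvk : ∃ k : K, v = 1 ⊗ₜ k := by
    refine ⟨∑ j ∈ (b.repr v).support, c j • B j, ?_⟩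
    rw [tmul_sum]
    conv_lhs => rw [← b.linearCombination_repr v, Finsupp.linearCombination_apply, Finsupp.sum]
    refine Finset.sum_congr rfl fun j _ => ?_
    rw [← hc j]
    simp [b, TensorProduct.smul_tmul']
  obtain ⟨k, rfl⟩ := hvk
  have hk : k ≠ 0 := by
    rintro rfl
    simp at hvi
  have : (1 : Q ⊗[C] K) ∈ N := by
    have := N.mul_mem_right _ ((1 : Q) ⊗ₜ[C] k⁻¹) hvN
    rwa [Algebra.TensorProduct.tmul_mul_tmul, mul_one, mul_inv_cancel₀ hk] at this
  exact (TwoSidedIdeal.one_mem_iff N).1 this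

/-- A central simple algebra of dimension four embeds into the two by two matrices over an
algebraic closure of its center, as a spanning set. -/
theorem exists_ringHom_matrix_of_isSimpleRing {C Q : Type*} [Field C] [Ring Q] [Algebra C Q]
    [IsSimpleRing Q] (hdim : Module.finrank C Q = 4)
    (hcentral : ∀ z : Q, (∀ x, x * z = z * x) → ∃ c, algebraMap C Q c = z) :
    ∃ φ : Q →+* Matrix (Fin 2) (Fin 2) (AlgebraicClosure C), Function.Injective φ ∧
      ∀ S : Set Q, Submodule.span C S = ⊤ → Submodule.span (AlgebraicClosure C) (φ '' S) = ⊤ := by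
  set K := AlgebraicClosure C
  have hs : IsSimpleRing (Q ⊗[C] K) := isSimpleRing_tensorProduct hcentral
  have hs' : IsSimpleRing (K ⊗[C] Q) :=
    IsSimpleRing.of_ringEquiv (Algebra.TensorProduct.comm C Q K).toRingEquiv hs
  have : Module.Finite C Q := Module.finite_of_finrank_pos (by omega)
  obtain ⟨n, -, ⟨e⟩⟩ := IsSimpleRing.exists_algEquiv_matrix_of_isAlgClosed K (K ⊗[C] Q)
  have hn : n * n = 4 := by
    have := e.toLinearEquiv.finrank_eq
    rw [Module.finrank_baseChange, hdim, Module.finrank_matrix] at this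
    simpa using this.symm
  obtain rfl : n = 2 := by nlinarith
  refine ⟨(e : K ⊗[C] Q →+* _).comp
    (Algebra.TensorProduct.includeRight : Q →ₐ[C] K ⊗[C] Q).toRingHom, RingHom.injective _,
    fun S hS => (Submodule.eq_top_iff').2 fun X => ?_⟩
  obtain ⟨t, rfl⟩ := e.surjective X
  induction t with
  | zero => simp
  | add s t hs ht => rw [map_add]; exact add_mem hs ht
  | tmul k q =>
    have hq : q ∈ Submodule.span C S := hS ▸ Submodule.mem_top
    rw [← mul_one k, ← smul_eq_mul, ← TensorProduct.smul_tmul', map_smul]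
    refine Submodule.smul_mem _ _ ?_
    induction hq using Submodule.span_induction with
    | mem x hx => exact Submodule.subset_span ⟨x, hx, rfl⟩
    | zero => simp
    | add x y _ _ hx hy => rw [tmul_add, map_add]; exact add_mem hx hy
    | smul c x _ hx =>
      rw [← TensorProduct.smul_tmul, ← algebraMap_smul K c (1 : K), ← TensorProduct.smul_tmul',
        map_smul]
      exact Submodule.smul_mem _ _ hx

/-- A ring that spans a four-dimensional prime algebra, centralized only by scalars, embeds into
two by two matrices over a field, as a spanning set. -/
theorem exists_nonUnitalRingHom_matrix {R : Type*} [NonUnitalRing R] [Nontrivial R]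
    {C : Type u} {T : Type*} [iC : CommRing C] [Ring T] [Algebra C T] (hC : IsField C)
    (ψ : R →ₙ+* T) (hψ : Function.Injective ψ)
    (hprime : ∀ a b : T, (∀ r, a * ψ r * b = 0) → a = 0 ∨ b = 0)
    (hcentral : ∀ z : T, (∀ r, ψ r * z = z * ψ r) → ∃ c, algebraMap C T c = z)
    (hdim : Module.finrank C (Submodule.span C (Set.range ψ)) = 4) :
    ∃ (K : Type u) (_ : Field K) (φ : R →ₙ+* Matrix (Fin 2) (Fin 2) K), Function.Injective φ ∧
      Submodule.span K (Set.range φ) = ⊤ := by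
  -- The field structure has to induce the given ring structure, on which the algebra structure of
  -- `T` depends.
  obtain ⟨F, rfl⟩ : ∃ F : Field C, F.toCommRing = iC := ⟨hC.toField, rfl⟩
  have : Nontrivial T := hψ.nontrivial
  have hS1 : Submodule.span C (Set.range ψ ∪ {1}) * Submodule.span C (Set.range ψ ∪ {1}) ≤
      Submodule.span C (Set.range ψ ∪ {1}) := by
    rw [Submodule.span_mul_span]
    refine Submodule.span_mono ?_
    rintro _ ⟨_, ⟨r, rfl⟩ | rfl, _, ⟨s, rfl⟩ | rfl, rfl⟩
    · exact Or.inl ⟨r * s, map_mul _ _ _⟩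
    · exact Or.inl ⟨r, (mul_one _).symm⟩
    · exact Or.inl ⟨s, (one_mul _).symm⟩
    · exact Or.inr (mul_one _)
  have hl : Submodule.span C (Set.range ψ ∪ {1}) * Submodule.span C (Set.range ψ) ≤
      Submodule.span C (Set.range ψ) := by
    rw [Submodule.span_mul_span]
    refine Submodule.span_mono ?_
    rintro _ ⟨_, ⟨r, rfl⟩ | rfl, _, ⟨s, rfl⟩, rfl⟩
    · exact ⟨r * s, map_mul _ _ _⟩
    · exact ⟨s, (one_mul _).symm⟩
  have hr : Submodule.span C (Set.range ψ) * Submodule.span C (Set.range ψ ∪ {1}) ≤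
      Submodule.span C (Set.range ψ) := by
    rw [Submodule.span_mul_span]
    refine Submodule.span_mono ?_
    rintro _ ⟨_, ⟨r, rfl⟩, _, ⟨s, rfl⟩ | rfl, rfl⟩
    · exact ⟨r * s, map_mul _ _ _⟩
    · exact ⟨r, (mul_one _).symm⟩
  -- The span of `ψ(R)` is not known to be unital, so 1 is adjoined. The enlarged algebra is simple
  -- and the span is a nonzero ideal of it, so nothing was added.
  let Q : Subalgebra C T := (Submodule.span C (Set.range ψ ∪ {1})).toSubalgebra
    (Submodule.subset_span (Or.inr rfl)) fun x y hx hy => hS1 (Submodule.mul_mem_mul hx hy)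
  have hψQ (r : R) : ψ r ∈ Q := Submodule.subset_span (Or.inl ⟨r, rfl⟩)
  have hfin : Module.Finite C (Submodule.span C (Set.range ψ)) :=
    Module.finite_of_finrank_pos (by omega)
  have hfinQ : Module.Finite C Q := by
    change Module.Finite C (Submodule.span C (Set.range ψ ∪ {1}) : Submodule C T)
    rw [Submodule.span_union]
    infer_instance
  have : IsArtinianRing Q := IsArtinianRing.of_finite C Q
  have : IsSimpleRing Q := isSimpleRing_of_isArtinianRing fun a b h =>
    (hprime a b fun r => congrArg Subtype.val (h ⟨ψ r, hψQ r⟩)).imp Subtype.ext Subtype.ext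
  have hle : Submodule.span C (Set.range ψ ∪ {1}) ≤ Submodule.span C (Set.range ψ) := by
    let N : TwoSidedIdeal Q := TwoSidedIdeal.mk' {q | (q : T) ∈ Submodule.span C (Set.range ψ)}
      (by simp) (fun h k => by simpa using add_mem h k) (fun h => by simpa using h)
      (fun {x y} h => hl (Submodule.mul_mem_mul x.2 h))
      (fun {x y} h => hr (Submodule.mul_mem_mul h y.2))
    obtain ⟨r, hr0⟩ := exists_ne (0 : R)
    have h1 : (1 : Q) ∈ N := IsSimpleRing.one_mem_of_ne_zero_mem _ (x := ⟨ψ r, hψQ r⟩)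
      (fun h => hr0 (hψ ((congrArg Subtype.val h).trans (map_zero ψ).symm)))
      ((TwoSidedIdeal.mem_mk' _ _ _ _ _ _ _).2 (Submodule.subset_span ⟨r, rfl⟩))
    rw [TwoSidedIdeal.mem_mk'] at h1
    refine Submodule.span_le.2 (Set.union_subset Submodule.subset_span ?_)
    rintro _ rfl
    exact h1
  have hdimQ : Module.finrank C Q = 4 := by
    rw [← hdim]
    exact congrArg (fun W : Submodule C T => Module.finrank C W)
      (le_antisymm hle (Submodule.span_mono Set.subset_union_left))
  obtain ⟨φ, hφ, hspan⟩ := exists_ringHom_matrix_of_isSimpleRing hdimQ fun z hz => by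
    obtain ⟨c, hc⟩ := hcentral z fun r => congrArg Subtype.val (hz ⟨ψ r, hψQ r⟩)
    exact ⟨c, Subtype.ext hc⟩
  let ψ' : R →ₙ+* Q :=
    { toFun r := ⟨ψ r, hψQ r⟩
      map_zero' := Subtype.ext (map_zero ψ)
      map_add' _ _ := Subtype.ext (map_add ψ _ _)
      map_mul' _ _ := Subtype.ext (map_mul ψ _ _) }
  have hψ'inj : Function.Injective ψ' := fun x y h => hψ (congrArg Subtype.val h)
  let χ : R →ₙ+* Matrix (Fin 2) (Fin 2) (AlgebraicClosure C) :=
    (φ : Q →ₙ+* Matrix (Fin 2) (Fin 2) (AlgebraicClosure C)).comp ψ'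
  have hχ : Function.Injective χ := fun x y h => hψ'inj (hφ h)
  refine ⟨AlgebraicClosure C, inferInstance, χ, hχ, ?_⟩
  have hψ' : Submodule.span C (Set.range ψ') = ⊤ := by
    refine Submodule.map_injective_of_injective (f := Q.val.toLinearMap)
      Subtype.val_injective ?_
    rw [Submodule.map_span, ← Set.range_comp, Submodule.map_top]
    ext x
    refine ⟨fun hx => ⟨⟨x, Submodule.span_mono Set.subset_union_left hx⟩, rfl⟩, ?_⟩
    rintro ⟨q, rfl⟩
    exact hle q.2
  have := hspan _ hψ'
  rwa [← Set.range_comp] at this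

end SimpleAlgebra

end PrimeRings

namespace PrimeRings

/-! ### The symmetric Martindale ring: primeness, and its center as a field. -/

namespace SymmQuotientRing

open BalancedPair

variable {R : Type*} [NonUnitalRing R] [IsPrimeRing R]

theorem eq_zero_of_forall_mul_eq_zero {J : TwoSidedIdeal R} (hJ : J ≠ ⊥) {r : R}
    (h : ∀ x ∈ J, r * x = 0) : r = 0 := by
  obtain ⟨x, hx, hx0⟩ := exists_ne_zero_of_ne_bot hJ
  refine (IsPrimeRing.eq_zero_or_eq_zero r x fun s => ?_).resolve_right hx0
  rw [mul_assoc, h _ (J.mul_mem_left _ _ hx)]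

theorem eq_zero_of_forall_mul_eq_zero' {J : TwoSidedIdeal R} (hJ : J ≠ ⊥) {r : R}
    (h : ∀ x ∈ J, x * r = 0) : r = 0 := by
  obtain ⟨x, hx, hx0⟩ := exists_ne_zero_of_ne_bot hJ
  refine (IsPrimeRing.eq_zero_or_eq_zero x r fun s => ?_).resolve_left hx0
  rw [h _ (J.mul_mem_right _ _ hx)]

theorem of_injective : Function.Injective (of R) := by
  refine (injective_iff_map_eq_zero _).2 fun r hr => ?_
  obtain ⟨K, hK, h⟩ := Quotient.exact hr
  refine eq_zero_of_forall_mul_eq_zero hK fun x hx => ?_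
  have : r * x = 0 * x := (h x hx).2.2.1
  rw [this, zero_mul]

/-- The element of `Q_s(R)` represented by a balanced pair. -/
def ofPair (p : BalancedPair R) : SymmQuotientRing R := Quotient.mk _ p

theorem exists_ofPair_eq (q : SymmQuotientRing R) : ∃ p, ofPair p = q :=
  Quotient.exists_rep q

theorem ofPair_mul_of (p : BalancedPair R) {x : R} (hx : x ∈ p.J) :
    ofPair p * of R x = of R (p.f x) :=
  Quotient.sound (Equiv.of_forall fun y hy _ =>
    ⟨p.f_mul x hx y, (p.balanced y (mem_of_mem_sq_left hy) x hx).symm⟩)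

theorem of_mul_ofPair (p : BalancedPair R) {x : R} (hx : x ∈ p.J) :
    of R x * ofPair p = of R (p.g x) :=
  Quotient.sound (Equiv.of_forall fun y hy _ =>
    ⟨p.balanced x hx y (mem_of_mem_sq_right hy), p.g_mul y x hx⟩)

theorem exists_ideal_mul_mem (q : SymmQuotientRing R) : ∃ J : TwoSidedIdeal R, J ≠ ⊥ ∧
    ∀ x ∈ J, (∃ r, q * of R x = of R r) ∧ ∃ r, of R x * q = of R r := by
  obtain ⟨p, rfl⟩ := exists_ofPair_eq q
  exact ⟨p.J, p.J_ne_bot, fun x hx => ⟨⟨_, ofPair_mul_of p hx⟩, _, of_mul_ofPair p hx⟩⟩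

theorem eq_zero_of_forall_mul_of {J : TwoSidedIdeal R} (hJ : J ≠ ⊥) {q : SymmQuotientRing R}
    (h : ∀ x ∈ J, q * of R x = 0) : q = 0 := by
  obtain ⟨p, rfl⟩ := exists_ofPair_eq q
  have hf : ∀ x ∈ J ⊓ p.J, p.f x = 0 := fun x hx => by
    rw [TwoSidedIdeal.mem_inf] at hx
    refine (map_eq_zero_iff _ of_injective).1 ?_
    rw [← ofPair_mul_of p hx.2]
    exact h x hx.1
  have hne := inf_ne_bot hJ p.J_ne_bot
  refine Quotient.sound ⟨_, hne, fun x hx =>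
    ⟨((TwoSidedIdeal.mem_inf R).1 hx).2, TwoSidedIdeal.mem_top R, ?_, ?_⟩⟩
  · exact (hf x hx).trans (zero_mul x).symm
  -- The balance condition carries the vanishing of `f` over to `g`.
  · refine Eq.trans (eq_zero_of_forall_mul_eq_zero hne fun y hy => ?_) (mul_zero x).symm
    rw [← p.balanced x ((TwoSidedIdeal.mem_inf R).1 hx).2 y ((TwoSidedIdeal.mem_inf R).1 hy).2,
      hf y hy, mul_zero]

theorem eq_zero_of_forall_of_mul {J : TwoSidedIdeal R} (hJ : J ≠ ⊥) {q : SymmQuotientRing R}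
    (h : ∀ x ∈ J, of R x * q = 0) : q = 0 := by
  obtain ⟨p, rfl⟩ := exists_ofPair_eq q
  have hg : ∀ x ∈ J ⊓ p.J, p.g x = 0 := fun x hx => by
    rw [TwoSidedIdeal.mem_inf] at hx
    refine (map_eq_zero_iff _ of_injective).1 ?_
    rw [← of_mul_ofPair p hx.2]
    exact h x hx.1
  have hne := inf_ne_bot hJ p.J_ne_bot
  refine Quotient.sound ⟨_, hne, fun x hx =>
    ⟨((TwoSidedIdeal.mem_inf R).1 hx).2, TwoSidedIdeal.mem_top R, ?_, ?_⟩⟩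
  · refine Eq.trans (eq_zero_of_forall_mul_eq_zero' hne fun y hy => ?_) (zero_mul x).symm
    rw [p.balanced y ((TwoSidedIdeal.mem_inf R).1 hy).2 x ((TwoSidedIdeal.mem_inf R).1 hx).2,
      hg y hy, zero_mul]
  · exact (hg x hx).trans (mul_zero x).symm

/-- Multiplying `a` on the left and `b` on the right by suitable elements of `R` gives nonzero
elements of `R`, where primeness applies. -/
theorem eq_zero_or_eq_zero_of_mul_of_mul {a b : SymmQuotientRing R}
    (h : ∀ r, a * of R r * b = 0) : a = 0 ∨ b = 0 := by
  by_contra! hab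
  obtain ⟨J, hJ, haJ⟩ := exists_ideal_mul_mem a
  obtain ⟨L, hL, hbL⟩ := exists_ideal_mul_mem b
  obtain ⟨x, hx, hx0⟩ : ∃ x ∈ J, of R x * a ≠ 0 := by
    by_contra! h
    exact hab.1 (eq_zero_of_forall_of_mul hJ h)
  obtain ⟨y, hy, hy0⟩ : ∃ y ∈ L, b * of R y ≠ 0 := by
    by_contra! h
    exact hab.2 (eq_zero_of_forall_mul_of hL h)
  obtain ⟨-, r, hr⟩ := haJ x hx
  obtain ⟨⟨s, hs⟩, -⟩ := hbL y hy
  rw [hr, map_ne_zero_iff _ of_injective] at hx0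
  rw [hs, map_ne_zero_iff _ of_injective] at hy0
  obtain ⟨t, ht⟩ := exists_mul_mul_ne_zero hx0 hy0
  refine ht (of_injective ?_)
  rw [map_mul, map_mul, ← hr, ← hs, map_zero,
    show of R x * a * of R t * (b * of R y) = of R x * (a * of R t * b) * of R y by noncomm_ring,
    h, mul_zero, zero_mul]

/-- If `p x ∈ R`, then `p q x = (p x) q = q (p x)`, and such `x` fill a nonzero ideal. -/
theorem mem_center_of_commute_of {q : SymmQuotientRing R} (h : ∀ r, of R r * q = q * of R r) :
    q ∈ Subring.center (SymmQuotientRing R) := by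
  refine Subring.mem_center_iff.2 fun p => ?_
  obtain ⟨J, hJ, hpJ⟩ := exists_ideal_mul_mem p
  rw [← sub_eq_zero]
  refine eq_zero_of_forall_mul_of hJ fun x hx => ?_
  obtain ⟨⟨r, hr⟩, -⟩ := hpJ x hx
  rw [sub_mul, mul_assoc, ← h, ← mul_assoc, hr, mul_assoc, hr, h, sub_self]

theorem of_mem_center {z : R} (hz : z ∈ Set.center R) :
    of R z ∈ Subring.center (SymmQuotientRing R) :=
  mem_center_of_commute_of fun r => by
    rw [← map_mul, ← map_mul, Semigroup.mem_center_iff.1 hz]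

theorem eq_zero_of_center_mul {c q : SymmQuotientRing R}
    (hc : c ∈ Subring.center (SymmQuotientRing R)) (hc0 : c ≠ 0) (h : c * q = 0) : q = 0 :=
  (eq_zero_or_eq_zero_of_mul_of_mul fun r => by
    rw [← Subring.mem_center_iff.1 hc, mul_assoc, h, mul_zero]).resolve_left hc0

/-- Multiplication by `c` is injective, so division by `c` is a well-defined bimodule map on the
ideal `L = cJ` and, used on both sides, represents the inverse. -/
theorem exists_mul_eq_one_of_mem_center {c : SymmQuotientRing R}
    (hc : c ∈ Subring.center (SymmQuotientRing R)) (hc0 : c ≠ 0) : ∃ q, c * q = 1 := by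
  classical
  have hcc := Subring.mem_center_iff.1 hc
  obtain ⟨J, hJ, hcJ⟩ := exists_ideal_mul_mem c
  let L : TwoSidedIdeal R := TwoSidedIdeal.mk' {r | ∃ x ∈ J, of R r = c * of R x}
    ⟨0, zero_mem _, by simp⟩
    (by
      rintro _ _ ⟨x, hx, h⟩ ⟨y, hy, k⟩
      exact ⟨x + y, add_mem hx hy, by rw [map_add, map_add, h, k, mul_add]⟩)
    (by
      rintro _ ⟨x, hx, h⟩
      exact ⟨-x, neg_mem hx, by rw [map_neg, map_neg, h, mul_neg]⟩)
    (by
      rintro r _ ⟨x, hx, h⟩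
      exact ⟨r * x, J.mul_mem_left _ _ hx, by
        rw [map_mul, map_mul, h, ← mul_assoc, hcc, mul_assoc]⟩)
    (by
      rintro _ r ⟨x, hx, h⟩
      exact ⟨x * r, J.mul_mem_right _ _ hx, by rw [map_mul, map_mul, h, mul_assoc]⟩)
  have hLmem {r : R} : r ∈ L ↔ ∃ x ∈ J, of R r = c * of R x :=
    TwoSidedIdeal.mem_mk' _ _ _ _ _ _ _
  have hinj {x y : R} (h : c * of R x = c * of R y) : x = y := by
    refine of_injective (sub_eq_zero.1 (eq_zero_of_center_mul hc hc0 ?_))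
    rw [mul_sub, h, sub_self]
  have hL : L ≠ ⊥ := by
    obtain ⟨x, hx, hx0⟩ := exists_ne_zero_of_ne_bot hJ
    obtain ⟨⟨r, hr⟩, -⟩ := hcJ x hx
    refine ne_bot_of_mem (hLmem.2 ⟨x, hx, hr.symm⟩) ?_
    rintro rfl
    refine hx0 (hinj ?_)
    rw [hr, map_zero, mul_zero]
  -- Outside `L` the value 0 is arbitrary: a balanced pair only sees its values on `L`.
  have hex : ∀ r, ∃ x, r ∈ L → of R r = c * of R x := fun r => by
    by_cases h : r ∈ L
    · obtain ⟨x, -, hx⟩ := hLmem.1 h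
      exact ⟨x, fun _ => hx⟩
    · exact ⟨0, fun h' => absurd h' h⟩
  choose f hf using hex
  let p : BalancedPair R :=
    { J := L
      J_ne_bot := hL
      f := f
      g := f
      f_add := fun x hx y hy => hinj (by
        rw [← hf _ (add_mem hx hy), map_add, map_add, mul_add, hf x hx, hf y hy])
      g_add := fun x hx y hy => hinj (by
        rw [← hf _ (add_mem hx hy), map_add, map_add, mul_add, hf x hx, hf y hy])
      f_mul := fun x hx r => hinj (by
        rw [← hf _ (L.mul_mem_right _ _ hx), map_mul, map_mul, ← mul_assoc, ← hf x hx])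
      g_mul := fun r x hx => hinj (by
        rw [← hf _ (L.mul_mem_left _ _ hx), map_mul, map_mul, ← mul_assoc, ← hcc, mul_assoc,
          ← hf x hx])
      balanced := fun x hx y hy => hinj (by
        rw [map_mul, map_mul, ← mul_assoc, ← mul_assoc, ← hf x hx, ← hcc, mul_assoc,
          ← hf y hy]) }
  refine ⟨ofPair p, sub_eq_zero.1 (eq_zero_of_forall_mul_of hL fun r hr => ?_)⟩
  rw [sub_mul, mul_assoc, ofPair_mul_of p hr, one_mul, hf r hr, sub_self]

instance : Nontrivial (SymmQuotientRing R) :=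
  of_injective.nontrivial

theorem isField_extendedCentroid : IsField (ExtendedCentroid R) where
  exists_pair_ne := ⟨0, 1, zero_ne_one⟩
  mul_comm := mul_comm
  mul_inv_cancel := by
    rintro ⟨c, hc⟩ hc0
    have hcc := Subring.mem_center_iff.1 hc
    obtain ⟨q, hq⟩ := exists_mul_eq_one_of_mem_center hc fun h => hc0 (Subtype.ext h)
    refine ⟨⟨q, Subring.mem_center_iff.2 fun p => ?_⟩, Subtype.ext hq⟩
    calc p * q = q * c * p * q := by rw [hcc, hq, one_mul]
      _ = q * p * (c * q) := by rw [mul_assoc q, ← hcc p]; simp only [mul_assoc]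
      _ = q * p := by rw [hq, mul_one]

end SymmQuotientRing

end PrimeRings

/-! ### The dichotomy for exceptional prime rings. -/

open PrimeRings SymmQuotientRing in
theorem theorem4 {R : Type*} [NonUnitalRing R] [PrimeRings.IsPrimeRing R]
    (hR : PrimeRings.IsExceptional R)
    (A : AddSubgroup R) (hA : ¬ ((A : Set R) ⊆ Set.center R))
    (I : TwoSidedIdeal R) (hI : I ≠ ⊥)
    (hAI : PrimeRings.commutatorSubgroup (A : Set R) (I : Set R) ≤ A) :
    (∃ L : AddSubgroup R, PrimeRings.IsProperLieIdeal L ∧ L ≤ A) ∨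
    (∃ a ∈ A, a ∉ Set.center R ∧ a * a ∈ Set.center R ∧
      PrimeRings.centroidSpan (A : Set R) =
        Submodule.span (PrimeRings.ExtendedCentroid R) {PrimeRings.SymmQuotientRing.of R a} ⊔
          Submodule.span (PrimeRings.ExtendedCentroid R) {1}) := by
  obtain ⟨hchar, hdim⟩ := hR
  rw [centroidSpan, Set.image_univ] at hdim
  obtain ⟨K, _, φ, hφ, hspan⟩ := exists_nonUnitalRingHom_matrix isField_extendedCentroid (of R)
    of_injective (fun a b h => eq_zero_or_eq_zero_of_mul_of_mul h)
    (fun z hz => ⟨⟨z, mem_center_of_commute_of hz⟩, rfl⟩) hdim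
  refine (exists_isProperLieIdeal_le_or hφ hspan hchar hA hI fun a ha x hx =>
    hAI (AddSubgroup.subset_closure ⟨a, ha, x, hx, rfl⟩)).imp id ?_
  rintro ⟨a, ha, hac, haa, l, hlA, hl, hl0, hA⟩
  refine ⟨a, ha, hac, haa, ?_⟩
  -- Dividing `l b = m a + v` by `l` in `C` puts `b` in `Ca + C`; since `l ∈ A`, also `1 = k l ∈
  -- AC`.
  obtain ⟨⟨k, hk⟩, hkl⟩ := isField_extendedCentroid.mul_inv_cancel
    (a := (⟨of R l, of_mem_center hl⟩ : ExtendedCentroid R))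
    fun h => hl0 (of_injective ((congrArg Subtype.val h).trans (map_zero _).symm))
  have hlk : of R l * k = 1 := congrArg Subtype.val hkl
  have hkc := Subring.mem_center_iff.1 hk
  refine le_antisymm (Submodule.span_le.2 ?_) (sup_le ?_ ?_)
  · rintro _ ⟨b, hb, rfl⟩
    obtain ⟨m, hm, v, hv, h⟩ := hA b hb
    refine Submodule.mem_sup.2
      ⟨(⟨k * of R m, mul_mem hk (of_mem_center hm)⟩ : ExtendedCentroid R) • of R a,
        Submodule.smul_mem _ _ (Submodule.mem_span_singleton_self _),
        (⟨k * of R v, mul_mem hk (of_mem_center hv)⟩ : ExtendedCentroid R) • 1,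
        Submodule.smul_mem _ _ (Submodule.mem_span_singleton_self _), ?_⟩
    change k * of R m * of R a + k * of R v * 1 = of R b
    rw [mul_one, mul_assoc, ← mul_add, ← map_mul, ← map_add, ← h, map_mul, ← mul_assoc, ← hkc,
      hlk, one_mul]
  · refine (Submodule.span_singleton_le_iff_mem _ _).2 (Submodule.subset_span ⟨a, ha, rfl⟩)
  · refine (Submodule.span_singleton_le_iff_mem _ _).2 ?_
    have : (⟨k, hk⟩ : ExtendedCentroid R) • of R l ∈ centroidSpan (A : Set R) :=
      Submodule.smul_mem _ _ (Submodule.subset_span ⟨l, hlA, rfl⟩)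
    rwa [show (⟨k, hk⟩ : ExtendedCentroid R) • of R l = 1 from (hkc _).symm.trans hlk] at this
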